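/- Let $N$ be a finite set. The entropy function of a random vector $(\xi_i)_{i\in N}$ whose components take finitely many values maps $I\subseteq N$ to the Shannon entropy (natural logarithm) of $(\xi_i)_{i\in I}$; let $H^{\mathrm{ent}}_N\subseteq\mathbb R^{\mathcal P(N)}$ be the set of all such functions (the entropy region) and $\mathrm{cl}(H^{\mathrm{ent}}_N)$ its closure. A polymatroid on $N$ is a function $h:\mathcal P(N)\to\mathbb R$ with $h(\emptyset)=0$ that is nondecreasing and submodular. It is tight if $h(N)=h(N\setminus\{i\})$ for all $i\in N$, and modular if $h(I)+h(J)=h(I\cup J)+h(I\cap J)$ for all disjoint $I,J\subseteq N$. Let $H^{\mathrm{ti}}_N$ and $H^{\mathrm{mod}}_N$ be the sets of tight and of modular polymatroids. Then $$\mathrm{cl}(H^{\mathrm{ent}}_N)=\bigl[\mathrm{cl}(H^{\mathrm{ent}}_N)\cap H^{\mathrm{ti}}_N\bigr]\oplus H^{\mathrm{mod}}_N ,$$ that is, both summands are convex cones containing the origin, their Minkowski sum is $\mathrm{cl}(H^{\mathrm{ent}}_N)$, and their linear hulls intersect only in the origin. Moreover, in the equivalent form of Chan's theorem on balanced information inequalities: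 for every $(\vartheta_I)_{I\subseteq N}\in\mathbb R^{\mathcal P(N)}$, the inequality $\sum_{I\subseteq N}\vartheta_I h(I)\le 0$ holds for all $h\in H^{\mathrm{ent}}_N$ if and only if $$\sum_{I\subseteq N}\vartheta_I h(I)-\sum_{i\in N}\bigl[h(N)-h(N\setminus\{i\})\bigr]\sum_{I\ni i}\vartheta_I\le 0\qquad\text{for all } h\in H^{\mathrm{ent}}_N,$$ and $\sum_{I\ni i}\vartheta_I\le 0$ for every $i\in N$. -/

import Mathlib

open scoped Pointwise

noncomputable section

namespace EntropyRegion

/-- The Shannon entropy (in nats) of a random variable `X` with values in a finite set `T`,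
on a probability space `(Ω, μ)`. -/
def shannonEntropy {Ω T : Type*} [MeasurableSpace Ω] [Fintype T]
    (μ : MeasureTheory.Measure Ω) (X : Ω → T) : ℝ :=
  ∑ x : T, Real.negMulLog (μ.real (X ⁻¹' {x}))

variable {N : Type*} [Fintype N] [DecidableEq N]

/-- The entropy function of a random vector `(ξ i)` indexed by `i : N`: it maps `I ⊆ N` to the
Shannon entropy of the subvector `(ξ i)` indexed by `i ∈ I`. -/
def entropyFunction {Ω : Type*} [MeasurableSpace Ω] (μ : MeasureTheory.Measure Ω)
    {S : N → Type*} [∀ i, Fintype (S i)] (ξ : ∀ i, Ω → S i) : Finset N → ℝ :=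
  fun I => shannonEntropy μ (fun (ω : Ω) (i : I) => ξ i ω)

variable (N) in
/-- The entropy region: all entropy functions of random vectors indexed by `N` whose components
take finitely many values, as a subset of the space of real functions on the power set of `N`. -/
def entropyRegion : Set (Finset N → ℝ) :=
  {h | ∃ (Ω : Type) (_ : MeasurableSpace Ω) (μ : MeasureTheory.Measure Ω)
      (_ : MeasureTheory.IsProbabilityMeasure μ)
      (S : N → Type) (_ : ∀ i, Fintype (S i)) (_ : ∀ i, MeasurableSpace (S i))
      (_ : ∀ i, MeasurableSingletonClass (S i)) (ξ : ∀ i, Ω → S i),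
      (∀ i, Measurable (ξ i)) ∧ h = entropyFunction μ ξ}

/-- `f` is the rank function of a polymatroid with ground set `N`. -/
structure IsPolymatroid (f : Finset N → ℝ) : Prop where
  empty : f ∅ = 0
  mono : ∀ I J : Finset N, I ⊆ J → f I ≤ f J
  submodular : ∀ I J : Finset N, 0 ≤ f I + f J - f (I ∪ J) - f (I ∩ J)

variable (N) in
/-- The cone of tight polymatroids: the rank of `N` equals the rank of each `N \ {i}`. -/
def tightCone : Set (Finset N → ℝ) :=
  {h | IsPolymatroid h ∧ ∀ i : N, h Finset.univ = h (Finset.univ \ {i})}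

variable (N) in
/-- The cone of modular polymatroids. -/
def modularCone : Set (Finset N → ℝ) :=
  {f | IsPolymatroid f ∧
    ∀ I J : Finset N, Disjoint I J → f I + f J - f (I ∪ J) - f (I ∩ J) = 0}

/-- `K` is the direct sum of the convex cones `A` and `B` (both containing the origin): it is
their Minkowski sum, and the linear hulls of `A` and `B` meet only in the origin. -/
structure IsDirectSumOfCones {E : Type*} [AddCommGroup E] [Module ℝ E] (K A B : Set E) :
    Prop where
  cone_left : ∃ P : PointedCone ℝ E, (P : Set E) = A
  cone_right : ∃ Q : PointedCone ℝ E, (Q : Set E) = B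
  eq_add : K = A + B
  disjoint : Disjoint (Submodule.span ℝ A) (Submodule.span ℝ B)

end EntropyRegion

end

/-! The heart is `tightenAt_mem_closureCone`: subtracting from `h` the modular function that charges
`h(N) - h(N \ {i})` to the element `i` does not leave the closure. Let `t = H(ξ_i | rest)`. If the
information of `ξ_i` given the rest is concentrated around `t`, a random hash `F` of `ξ_i` with
about `exp t` values is nearly uniform and nearly independent of the rest
(`exists_hash_of_concentrated`). Conditioning on `F` then does what is wanted: if `i ∈ I`, then `F`
is a function of `ξ_I` and about `t` is lost; if `i ∉ I`, almost nothing is lost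
(`exists_near_tightenAt`). Independent copies supply the concentration: after `n` copies the mean
absolute deviation is `o(n)`, and dividing by `n` removes the error.

This uses that the closure is a convex cone. Sums come from independent pairs, scaling from rarely
activated copies (`smul_mem_closure_entropyRegion`), and conditional entropies are averages of
entropy vectors (`condEntropy_mem_closureCone`).

Tightening at every element in turn splits `h` into a tight part in the closure and a modular part
with nonnegative weights; conversely, modular polymatroids are sums of scaled coins. The balanced
inequality is the original one evaluated on the two summands. -/

namespace EntropyRegion

open Finset

/-! ### Shannon entropy on finite weighted spaces. -/

section WeightedSpaces

variable {Ω Ω' T T' U : Type*} [Fintype Ω] [Fintype Ω']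

open Classical in
/-- The total weight of the points at which `X` takes the same value as at `ω`. -/
noncomputable def classMass (p : Ω → ℝ) (X : Ω → T) (ω : Ω) : ℝ :=
  ∑ a, if X a = X ω then p a else 0

/-- The Shannon entropy of `X` on a finite space with weights `p`. -/
noncomputable def weightedEntropy (p : Ω → ℝ) (X : Ω → T) : ℝ :=
  -∑ ω, p ω * Real.log (classMass p X ω)

lemma classMass_congr (p : Ω → ℝ) {X : Ω → T} {Y : Ω → U}
    (h : ∀ a b, X a = X b ↔ Y a = Y b) (ω : Ω) : classMass p X ω = classMass p Y ω := by
  classical exact sum_congr rfl fun _ _ => if_congr (h _ _) rfl rfl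

lemma weightedEntropy_congr (p : Ω → ℝ) {X : Ω → T} {Y : Ω → U}
    (h : ∀ a b, X a = X b ↔ Y a = Y b) : weightedEntropy p X = weightedEntropy p Y := by
  simp only [weightedEntropy, classMass_congr p h]

lemma classMass_eq_of_eq (p : Ω → ℝ) (X : Ω → T) {a b : Ω} (h : X a = X b) :
    classMass p X a = classMass p X b := by
  classical exact sum_congr rfl fun _ _ => if_congr (by rw [h]) rfl rfl

lemma classMass_comp_equiv (p : Ω → ℝ) (X : Ω → T) (e : Ω' ≃ Ω) (ω : Ω') :
    classMass (p ∘ e) (X ∘ e) ω = classMass p X (e ω) := by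
  classical
  simp only [classMass, Function.comp]
  exact e.sum_comp fun a => if X a = X (e ω) then p a else 0

lemma weightedEntropy_comp_equiv (p : Ω → ℝ) (X : Ω → T) (e : Ω' ≃ Ω) :
    weightedEntropy (p ∘ e) (X ∘ e) = weightedEntropy p X := by
  simp only [weightedEntropy, classMass_comp_equiv, Function.comp]
  rw [e.sum_comp fun a => p a * Real.log (classMass p X a)]

open Classical in
lemma sum_negMulLog_eq_weightedEntropy [Fintype T] (p : Ω → ℝ) (X : Ω → T) :
    ∑ x, Real.negMulLog (∑ a, if X a = x then p a else 0) = weightedEntropy p X := by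
  simp only [Real.negMulLog, weightedEntropy, neg_mul, sum_neg_distrib, sum_mul, ite_mul, zero_mul]
  rw [sum_comm]
  simp [classMass]

variable {p : Ω → ℝ}

lemma classMass_nonneg (hp : ∀ ω, 0 ≤ p ω) (X : Ω → T) (ω : Ω) : 0 ≤ classMass p X ω :=
  sum_nonneg fun a _ => by split_ifs <;> simp [hp]

lemma le_classMass (hp : ∀ ω, 0 ≤ p ω) (X : Ω → T) (ω : Ω) : p ω ≤ classMass p X ω := by
  classical
  have := single_le_sum (f := fun a => if X a = X ω then p a else 0)
    (fun a _ => by split_ifs <;> simp [hp]) (mem_univ ω)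
  simpa [classMass] using this

lemma classMass_pos (hp : ∀ ω, 0 ≤ p ω) (X : Ω → T) {ω : Ω} (h : p ω ≠ 0) :
    0 < classMass p X ω :=
  lt_of_lt_of_le (lt_of_le_of_ne (hp ω) h.symm) (le_classMass hp X ω)

lemma classMass_mono (hp : ∀ ω, 0 ≤ p ω) {X : Ω → T} {Y : Ω → U}
    (h : ∀ a b, X a = X b → Y a = Y b) (ω : Ω) : classMass p X ω ≤ classMass p Y ω := by
  classical
  refine sum_le_sum fun a _ => ?_
  by_cases hX : X a = X ω
  · simp [hX, h _ _ hX]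
  · simp only [hX, if_false]
    split_ifs <;> simp [hp]

lemma weightedEntropy_mono (hp : ∀ ω, 0 ≤ p ω) {X : Ω → T} {Y : Ω → U}
    (h : ∀ a b, X a = X b → Y a = Y b) : weightedEntropy p Y ≤ weightedEntropy p X := by
  refine neg_le_neg (sum_le_sum fun ω _ => ?_)
  by_cases h0 : p ω = 0
  · simp [h0]
  · exact mul_le_mul_of_nonneg_left
      (Real.log_le_log (classMass_pos hp X h0) (classMass_mono hp h ω)) (hp ω)

lemma weightedEntropy_of_subsingleton (hp : p ∈ stdSimplex ℝ Ω) {X : Ω → T}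
    (h : ∀ a b, X a = X b) : weightedEntropy p X = 0 := by
  have h1 : ∀ ω, classMass p X ω = 1 := fun ω => by simp [classMass, h _ ω, hp.2]
  simp [weightedEntropy, h1]

-- The denominator is constant on a fibre and equals its weight. The sum is 1, or 0 when the fibre
-- is null, hence only an inequality.
open Classical in
lemma sum_fiber_div_classMass_le_one (p : Ω → ℝ) (X : Ω → T) (x : T) :
    ∑ ω, (if X ω = x then p ω / classMass p X ω else 0) ≤ 1 := by
  have h : ∀ ω, (if X ω = x then p ω / classMass p X ω else 0) =
      (if X ω = x then p ω else 0) / ∑ a, if X a = x then p a else 0 := by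
    intro ω
    by_cases hx : X ω = x
    · simp [hx, classMass]
    · simp [hx]
  simp only [h]
  rw [← sum_div]
  exact div_self_le_one _

/-- Gibbs' inequality against the uniform law on `T`, from `log x ≤ x - 1` at `x = 1 / (M *
classMass p X ω)`. -/
lemma weightedEntropy_le_log_card [Fintype T] (hp : p ∈ stdSimplex ℝ Ω) (X : Ω → T) :
    weightedEntropy p X ≤ Real.log (Fintype.card T) := by
  classical
  have hne : Nonempty Ω := by
    by_contra h
    rw [not_nonempty_iff] at h
    simpa using hp.2
  have hM : (0 : ℝ) < Fintype.card T := by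
    have : Nonempty T := hne.map X
    exact_mod_cast Fintype.card_pos
  set M : ℝ := (Fintype.card T : ℝ)
  have key : ∀ ω, -(p ω * Real.log (classMass p X ω)) ≤
      p ω * (Real.log M - 1) + p ω / classMass p X ω / M := by
    intro ω
    by_cases h0 : p ω = 0
    · simp [h0]
    have hm := classMass_pos hp.1 X h0
    have := Real.log_le_sub_one_of_pos (x := 1 / (M * classMass p X ω)) (by positivity)
    rw [one_div, Real.log_inv, Real.log_mul hM.ne' hm.ne'] at this
    have h2 := mul_le_mul_of_nonneg_left this (hp.1 ω)
    have h3 : p ω * (M * classMass p X ω)⁻¹ = p ω / classMass p X ω / M := by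
      field_simp
    linarith
  have hsum : ∑ ω, p ω / classMass p X ω ≤ M := by
    calc ∑ ω, p ω / classMass p X ω
        = ∑ x, ∑ ω, (if X ω = x then p ω / classMass p X ω else 0) := by
          rw [sum_comm]; simp
      _ ≤ ∑ _x : T, (1 : ℝ) := sum_le_sum fun x _ => sum_fiber_div_classMass_le_one p X x
      _ = M := by simp [M]
  calc weightedEntropy p X = ∑ ω, -(p ω * Real.log (classMass p X ω)) := by
        simp [weightedEntropy]
    _ ≤ ∑ ω, (p ω * (Real.log M - 1) + p ω / classMass p X ω / M) := sum_le_sum fun ω _ => key ω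
    _ = Real.log M - 1 + (∑ ω, p ω / classMass p X ω) / M := by
        rw [sum_add_distrib, ← sum_mul, hp.2, one_mul, sum_div]
    _ ≤ Real.log M - 1 + 1 := by gcongr; exact (div_le_one hM).2 hsum
    _ = Real.log M := by ring

/-- The ratio compares the law making `X` and `Y` conditionally independent given `Z` with their
actual joint law, so its mean is at most a total mass 1. Applying `log x ≤ x - 1` to it yields
submodularity. -/
lemma sum_mul_classMass_div_le_one (hp : p ∈ stdSimplex ℝ Ω) {X : Ω → T} {Y : Ω → T'} {Z : Ω → U}
    (hX : ∀ a b, X a = X b → Z a = Z b) (hY : ∀ a b, Y a = Y b → Z a = Z b) :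
    ∑ ω, p ω * (classMass p X ω * classMass p Y ω /
      (classMass p (fun ω => (X ω, Y ω)) ω * classMass p Z ω)) ≤ 1 := by
  classical
  set W : Ω → T × T' := fun ω => (X ω, Y ω) with hW
  have expand : ∀ ω, p ω * (classMass p X ω * classMass p Y ω /
      (classMass p W ω * classMass p Z ω)) = ∑ a, ∑ b, (if Z b = Z a then p a * p b else 0) /
        classMass p Z a * (if W ω = (X a, Y b) then p ω / classMass p W ω else 0) := by
    intro ω
    have h1 : p ω * (classMass p X ω * classMass p Y ω / (classMass p W ω * classMass p Z ω)) =
      (classMass p X ω * classMass p Y ω) * (p ω / classMass p W ω / classMass p Z ω) := by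
      rw [div_div]; ring
    rw [h1]
    conv_lhs => rw [classMass, classMass, sum_mul_sum, sum_mul]
    refine sum_congr rfl fun a _ => ?_
    rw [sum_mul]
    refine sum_congr rfl fun b _ => ?_
    by_cases ha : X a = X ω
    · by_cases hb : Y b = Y ω
      · have hZ : Z b = Z a := (hY _ _ hb).trans (hX _ _ ha).symm
        have hm := classMass_eq_of_eq p Z (hX _ _ ha)
        simp only [hW, ha, hb, hZ, hm, if_true]
        ring
      · have : ¬ Y ω = Y b := fun h => hb h.symm
        simp [hW, hb, this]
    · have : ¬ X ω = X a := fun h => ha h.symm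
      simp [hW, ha, this]
  simp only [expand]
  rw [sum_comm]
  calc ∑ a, ∑ ω, ∑ b, (if Z b = Z a then p a * p b else 0) / classMass p Z a *
          (if W ω = (X a, Y b) then p ω / classMass p W ω else 0)
      = ∑ a, ∑ b, (if Z b = Z a then p a * p b else 0) / classMass p Z a *
          ∑ ω, (if W ω = (X a, Y b) then p ω / classMass p W ω else 0) := by
        refine sum_congr rfl fun a _ => ?_
        rw [sum_comm]
        simp only [mul_sum]
    _ ≤ ∑ a, ∑ b, (if Z b = Z a then p a * p b else 0) / classMass p Z a := by
        refine sum_le_sum fun a _ => sum_le_sum fun b _ => ?_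
        refine mul_le_of_le_one_right (div_nonneg ?_ (classMass_nonneg hp.1 Z a))
          ((le_of_eq (by congr!)).trans (sum_fiber_div_classMass_le_one p W (X a, Y b)))
        split_ifs
        · exact mul_nonneg (hp.1 a) (hp.1 b)
        · exact le_rfl
    _ = ∑ a, p a * (classMass p Z a / classMass p Z a) := by
        refine sum_congr rfl fun a _ => ?_
        rw [← sum_div, ← mul_div_assoc]
        congr 1
        simp [classMass, mul_sum]
    _ ≤ ∑ a, p a := sum_le_sum fun a _ => mul_le_of_le_one_right (hp.1 a) (div_self_le_one _)
    _ = 1 := hp.2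

/-- Submodularity of entropy: if `Z` is a function of `X` and a function of `Y`, then
`H(X, Y) + H(Z) ≤ H(X) + H(Y)`. -/
lemma weightedEntropy_submodular (hp : p ∈ stdSimplex ℝ Ω) {X : Ω → T} {Y : Ω → T'} {Z : Ω → U}
    (hX : ∀ a b, X a = X b → Z a = Z b) (hY : ∀ a b, Y a = Y b → Z a = Z b) :
    weightedEntropy p (fun ω => (X ω, Y ω)) + weightedEntropy p Z ≤
      weightedEntropy p X + weightedEntropy p Y := by
  have hsum := sum_mul_classMass_div_le_one hp hX hY
  set W : Ω → T × T' := fun ω => (X ω, Y ω)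
  have key : ∀ ω, p ω * Real.log (classMass p X ω) + p ω * Real.log (classMass p Y ω) -
      p ω * Real.log (classMass p W ω) - p ω * Real.log (classMass p Z ω) ≤
      p ω * (classMass p X ω * classMass p Y ω / (classMass p W ω * classMass p Z ω)) - p ω := by
    intro ω
    by_cases h0 : p ω = 0
    · simp [h0]
    have h1 := classMass_pos hp.1 X h0
    have h2 := classMass_pos hp.1 Y h0
    have h3 := classMass_pos hp.1 Z h0
    have h4 := classMass_pos hp.1 W h0
    have := Real.log_le_sub_one_of_pos
      (x := classMass p X ω * classMass p Y ω / (classMass p W ω * classMass p Z ω)) (by positivity)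
    rw [Real.log_div (by positivity) (by positivity), Real.log_mul h1.ne' h2.ne',
      Real.log_mul h4.ne' h3.ne'] at this
    have := mul_le_mul_of_nonneg_left this (hp.1 ω)
    linarith
  have := sum_le_sum fun ω (_ : ω ∈ univ) => key ω
  simp only [sum_sub_distrib, sum_add_distrib, hp.2] at this
  simp only [weightedEntropy]
  linarith

/-- The product of two weight functions. -/
def prodWeight (p : Ω → ℝ) (q : Ω' → ℝ) : Ω × Ω' → ℝ := fun z => p z.1 * q z.2

lemma prodWeight_mem {q : Ω' → ℝ} (hp : p ∈ stdSimplex ℝ Ω) (hq : q ∈ stdSimplex ℝ Ω') :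
    prodWeight p q ∈ stdSimplex ℝ (Ω × Ω') := by
  refine ⟨fun z => mul_nonneg (hp.1 _) (hq.1 _), ?_⟩
  simp only [prodWeight]
  rw [Fintype.sum_prod_type, ← sum_mul_sum, hp.2, hq.2, one_mul]

lemma classMass_prodWeight (p : Ω → ℝ) (q : Ω' → ℝ) {X : Ω → T} {Y : Ω' → T'} {Z : Ω × Ω' → U}
    (hZ : ∀ a b, Z a = Z b ↔ X a.1 = X b.1 ∧ Y a.2 = Y b.2) (z : Ω × Ω') :
    classMass (prodWeight p q) Z z = classMass p X z.1 * classMass q Y z.2 := by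
  classical
  simp only [classMass, hZ, prodWeight]
  rw [Fintype.sum_prod_type, sum_mul_sum]
  refine sum_congr rfl fun a _ => sum_congr rfl fun b _ => ?_
  by_cases h1 : X a = X z.1 <;> by_cases h2 : Y b = Y z.2 <;> simp [h1, h2]

lemma log_classMass_prodWeight {q : Ω' → ℝ} (hp : ∀ ω, 0 ≤ p ω) (hq : ∀ ω, 0 ≤ q ω)
    {X : Ω → T} {Y : Ω' → T'} {Z : Ω × Ω' → U}
    (hZ : ∀ a b, Z a = Z b ↔ X a.1 = X b.1 ∧ Y a.2 = Y b.2) (z : Ω × Ω')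
    (hz : prodWeight p q z ≠ 0) :
    Real.log (classMass (prodWeight p q) Z z) =
      Real.log (classMass p X z.1) + Real.log (classMass q Y z.2) := by
  rw [classMass_prodWeight p q hZ, Real.log_mul]
  · exact (classMass_pos hp X (left_ne_zero_of_mul hz)).ne'
  · exact (classMass_pos hq Y (right_ne_zero_of_mul hz)).ne'

lemma sum_prodWeight_mul_add {q : Ω' → ℝ} (hp : p ∈ stdSimplex ℝ Ω) (hq : q ∈ stdSimplex ℝ Ω')
    (u : Ω → ℝ) (v : Ω' → ℝ) :
    ∑ z, prodWeight p q z * (u z.1 + v z.2) = ∑ a, p a * u a + ∑ b, q b * v b := by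
  have : ∀ z : Ω × Ω', prodWeight p q z * (u z.1 + v z.2) =
      (p z.1 * u z.1) * q z.2 + p z.1 * (q z.2 * v z.2) := fun z => by
    simp only [prodWeight]; ring
  simp only [this, sum_add_distrib, Fintype.sum_prod_type]
  rw [← sum_mul_sum, ← sum_mul_sum, hp.2, hq.2, one_mul, mul_one]

lemma weightedEntropy_prodWeight {q : Ω' → ℝ} (hp : p ∈ stdSimplex ℝ Ω)
    (hq : q ∈ stdSimplex ℝ Ω') {X : Ω → T} {Y : Ω' → T'} {Z : Ω × Ω' → U}
    (hZ : ∀ a b, Z a = Z b ↔ X a.1 = X b.1 ∧ Y a.2 = Y b.2) :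
    weightedEntropy (prodWeight p q) Z = weightedEntropy p X + weightedEntropy q Y := by
  have h : ∀ z, prodWeight p q z * Real.log (classMass (prodWeight p q) Z z) =
      prodWeight p q z * (Real.log (classMass p X z.1) + Real.log (classMass q Y z.2)) := by
    intro z
    by_cases hz : prodWeight p q z = 0
    · simp [hz]
    · rw [log_classMass_prodWeight hp.1 hq.1 hZ z hz]
  simp only [weightedEntropy, h]
  rw [sum_prodWeight_mul_add hp hq (fun a => Real.log (classMass p X a))
    fun b => Real.log (classMass q Y b)]
  ring

/-- The weights on `Option Ω` giving `none` the weight `1 - δ` and `Ω` the total weight `δ`. -/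
def optionWeight (δ : ℝ) (p : Ω → ℝ) : Option Ω → ℝ
  | none => 1 - δ
  | some ω => δ * p ω

lemma optionWeight_mem {δ : ℝ} (h0 : 0 ≤ δ) (h1 : δ ≤ 1) (hp : p ∈ stdSimplex ℝ Ω) :
    optionWeight δ p ∈ stdSimplex ℝ (Option Ω) := by
  refine ⟨?_, ?_⟩
  · rintro (_ | ω)
    · simpa [optionWeight] using h1
    · exact mul_nonneg h0 (hp.1 ω)
  · simp [Fintype.sum_option, optionWeight, ← mul_sum, hp.2]

/-- Grouping rule: `Z` reveals whether the point is `none`, and with probability `δ` also the value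
of `X`. -/
lemma weightedEntropy_optionWeight {δ : ℝ} (h0 : 0 < δ) (hp : p ∈ stdSimplex ℝ Ω)
    {X : Ω → T} {Z : Option Ω → U} (hn : ∀ a, Z (some a) ≠ Z none)
    (hs : ∀ a b, Z (some a) = Z (some b) ↔ X a = X b) :
    weightedEntropy (optionWeight δ p) Z = δ * weightedEntropy p X + Real.binEntropy δ := by
  classical
  have hm0 : classMass (optionWeight δ p) Z none = 1 - δ := by
    simp [classMass, Fintype.sum_option, hn, optionWeight]
  have hm : ∀ ω, classMass (optionWeight δ p) Z (some ω) = δ * classMass p X ω := by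
    intro ω
    simp [classMass, Fintype.sum_option, (hn _).symm, optionWeight, hs, mul_sum]
  have hl : ∀ ω, δ * p ω * Real.log (δ * classMass p X ω) =
      δ * Real.log δ * p ω + δ * (p ω * Real.log (classMass p X ω)) := by
    intro ω
    by_cases hz : p ω = 0
    · simp [hz]
    · rw [Real.log_mul h0.ne' (classMass_pos hp.1 X hz).ne']
      ring
  simp only [weightedEntropy, Fintype.sum_option, hm0, hm]
  simp only [optionWeight, hl, sum_add_distrib, ← mul_sum, hp.2,
    Real.binEntropy_eq_negMulLog_add_negMulLog_one_sub, Real.negMulLog]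
  ring

/-- The weights `p` conditioned on `F = v`. -/
noncomputable def condWeight (p : Ω → ℝ) (F : Ω → T) (v : T) : Ω → ℝ :=
  open Classical in fun ω => (if F ω = v then p ω else 0) / ∑ a, if F a = v then p a else 0

open Classical in
lemma condWeight_mem (hp : ∀ ω, 0 ≤ p ω) {F : Ω → T} {v : T}
    (hv : ∑ a, (if F a = v then p a else 0) ≠ 0) : condWeight p F v ∈ stdSimplex ℝ Ω := by
  have h : ∀ ω, 0 ≤ (if F ω = v then p ω else 0) := fun ω => by split_ifs <;> simp [hp]
  refine ⟨fun ω => div_nonneg (h ω) (sum_nonneg fun a _ => h a), ?_⟩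
  simp only [condWeight]
  rw [← sum_div, div_self hv]

-- Chain rule. A null value `v` contributes zero on the left through its factor.
open Classical in
lemma weightedEntropy_condWeight [Fintype T] (hp : ∀ ω, 0 ≤ p ω) (X : Ω → U) (F : Ω → T) :
    ∑ v, (∑ a, if F a = v then p a else 0) * weightedEntropy (condWeight p F v) X =
      weightedEntropy p (fun ω => (X ω, F ω)) - weightedEntropy p F := by
  have hm : ∀ ω, classMass (condWeight p F (F ω)) X ω =
      classMass p (fun ω => (X ω, F ω)) ω / classMass p F ω := by
    intro ω
    simp only [classMass, condWeight, sum_div, Prod.mk.injEq]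
    refine sum_congr rfl fun a _ => ?_
    by_cases h1 : X a = X ω <;> by_cases h2 : F a = F ω <;> simp [h1, h2]
  have h : ∀ v, (∑ a, if F a = v then p a else 0) * weightedEntropy (condWeight p F v) X =
      ∑ ω, if F ω = v then -(p ω * Real.log (classMass p (fun ω => (X ω, F ω)) ω)) +
        p ω * Real.log (classMass p F ω) else 0 := by
    intro v
    rw [weightedEntropy, mul_neg, mul_sum, ← sum_neg_distrib]
    refine sum_congr rfl fun ω _ => ?_
    by_cases hF : F ω = v
    · subst hF
      rw [hm]
      by_cases h0 : p ω = 0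
      · simp [condWeight, h0]
      have h1 := classMass_pos hp F h0
      have h2 := classMass_pos hp (fun ω => (X ω, F ω)) h0
      rw [Real.log_div h2.ne' h1.ne']
      have : ∑ a, (if F a = F ω then p a else 0) = classMass p F ω := by simp [classMass]
      simp only [condWeight, if_true, this]
      field_simp
      ring
    · simp [condWeight, hF]
  simp only [h]
  rw [sum_comm]
  simp [weightedEntropy, sum_add_distrib]

end WeightedSpaces

/-! ### The entropy region and the cone structure of its closure. -/

section Region

variable {N Ω Ω' : Type*} {S S' : N → Type*}

lemma subvector_eq_iff (ξ : ∀ i, Ω → S i) (I : Finset N) (a b : Ω) :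
    (fun i : I => ξ i a) = (fun i : I => ξ i b) ↔ ∀ i ∈ I, ξ i a = ξ i b := by
  simp [funext_iff]

variable [Fintype Ω] [Fintype Ω']

/-- The joint entropies of the families `(ξ i)`, `i ∈ I`, on a finite space with weights `p`. -/
noncomputable def entropyVector (p : Ω → ℝ) (ξ : ∀ i, Ω → S i) (I : Finset N) : ℝ :=
  weightedEntropy p fun ω (i : I) => ξ i ω

lemma entropyVector_mem {N : Type*} [Fintype N] [DecidableEq N] {S : N → Type*} {p : Ω → ℝ}
    (hp : p ∈ stdSimplex ℝ Ω) (ξ : ∀ i, Ω → S i) : entropyVector p ξ ∈ entropyRegion N := by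
  classical
  let e := (Fintype.equivFin Ω).symm
  -- The region requires spaces in `Type` and finite alphabets. Transport to `Fin` settles the
  -- former; replacing each `ξ i` by the quotient by its kernel settles both for the alphabets and
  -- keeps all entropies.
  let q : PMF (Fin (Fintype.card Ω)) := PMF.ofFintype (fun j => ENNReal.ofReal (p (e j))) (by
    rw [← ENNReal.ofReal_sum_of_nonneg fun j _ => hp.1 (e j), e.sum_comp, hp.2,
      ENNReal.ofReal_one])
  let _ : MeasurableSpace (Fin (Fintype.card Ω)) := ⊤
  let R : ∀ i, Setoid (Fin (Fintype.card Ω)) := fun i => Setoid.ker (ξ i ∘ e)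
  let η : ∀ i, Fin (Fintype.card Ω) → Quotient (R i) := fun i j => Quotient.mk _ j
  refine ⟨Fin (Fintype.card Ω), ⊤, q.toMeasure, inferInstance, fun i => Quotient (R i),
    fun i => inferInstance, fun i => ⊤, fun i => ⟨fun _ => trivial⟩, η,
    fun i => measurable_from_top, ?_⟩
  have hq : ∀ s : Set (Fin (Fintype.card Ω)), q.toMeasure.real s =
      ∑ j, if j ∈ s then (p ∘ e) j else 0 := by
    intro s
    rw [MeasureTheory.Measure.real, PMF.toMeasure_apply_fintype, ENNReal.toReal_sum]
    · refine sum_congr rfl fun j _ => ?_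
      by_cases hj : j ∈ s <;> simp [hj, q, hp.1 (e j)]
    · intro j _
      by_cases hj : j ∈ s <;> simp [hj, q]
  funext I
  simp only [entropyFunction, shannonEntropy, hq, Set.mem_preimage, Set.mem_singleton_iff]
  have h := sum_negMulLog_eq_weightedEntropy (p ∘ e)
    (fun j (i : I) => η i j)
  rw [entropyVector, ← weightedEntropy_comp_equiv p _ e]
  refine Eq.trans (weightedEntropy_congr _ fun a b => ?_) (h.symm.trans ?_)
  · rw [Function.comp, Function.comp, subvector_eq_iff ξ, subvector_eq_iff η]
    refine forall₂_congr fun i _ => ?_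
    exact (Quotient.eq (r := R i)).symm
  · congr!

-- Only the joint law matters: it lives on the product of the alphabets, with the coordinates as
-- random variables.
universe u in
lemma exists_eq_entropyVector {N : Type u} [Fintype N] [DecidableEq N] {h : Finset N → ℝ}
    (hh : h ∈ entropyRegion N) : ∃ (Ω : Type u) (_ : Fintype Ω) (S : N → Type)
      (_ : ∀ i, Fintype (S i)) (p : Ω → ℝ) (ξ : ∀ i, Ω → S i),
      p ∈ stdSimplex ℝ Ω ∧ h = entropyVector p ξ := by
  classical
  obtain ⟨Ω, _, μ, _, S, _, _, _, ξ, hξ, rfl⟩ := hh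
  let V : Ω → ∀ i, S i := fun ω i => ξ i ω
  have hV : ∀ x : ∀ i, S i, MeasurableSet (V ⁻¹' {x}) := by
    intro x
    have : V ⁻¹' {x} = ⋂ i, ξ i ⁻¹' {x i} := by
      ext ω; simp [V, funext_iff]
    rw [this]
    exact MeasurableSet.iInter fun i => hξ i (measurableSet_singleton _)
  let p : (∀ i, S i) → ℝ := fun x => μ.real (V ⁻¹' {x})
  have hsum : ∀ s : Finset (∀ i, S i), ∑ x ∈ s, p x = μ.real (V ⁻¹' s) := fun s =>
    MeasureTheory.sum_measureReal_preimage_singleton s fun x _ => hV x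
  refine ⟨∀ i, S i, inferInstance, S, inferInstance, p, fun i x => x i, ⟨fun x => ?_, ?_⟩, ?_⟩
  · exact MeasureTheory.measureReal_nonneg
  · rw [hsum]; simp
  · funext I
    rw [entropyVector, ← sum_negMulLog_eq_weightedEntropy]
    simp only [entropyFunction, shannonEntropy]
    refine sum_congr rfl fun y _ => ?_
    have : (fun ω (i : I) => ξ i ω) ⁻¹' {y} = V ⁻¹' 
        ↑({x : ∀ i, S i | (fun i : I => x i) = y} : Finset _) := by
      ext ω
      simp [V]
    rw [this, ← hsum, sum_filter]
    congr!

lemma entropyVector_prodWeight {p : Ω → ℝ} {q : Ω' → ℝ} (hp : p ∈ stdSimplex ℝ Ω)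
    (hq : q ∈ stdSimplex ℝ Ω') (ξ : ∀ i, Ω → S i) (η : ∀ i, Ω' → S' i) :
    entropyVector (prodWeight p q) (fun i z => (ξ i z.1, η i z.2)) =
      entropyVector p ξ + entropyVector q η := by
  funext I
  refine weightedEntropy_prodWeight hp hq fun a b => ?_
  rw [subvector_eq_iff, subvector_eq_iff, subvector_eq_iff fun i (z : Ω × Ω') => (ξ i z.1, η i z.2)]
  simp only [Prod.mk.injEq]
  exact ⟨fun h => ⟨fun i hi => (h i hi).1, fun i hi => (h i hi).2⟩,
    fun h i hi => ⟨h.1 i hi, h.2 i hi⟩⟩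

variable [DecidableEq N]

lemma isPolymatroid_entropyVector {p : Ω → ℝ} (hp : p ∈ stdSimplex ℝ Ω) (ξ : ∀ i, Ω → S i) :
    IsPolymatroid (entropyVector p ξ) where
  empty := weightedEntropy_of_subsingleton hp fun a b => by simp [subvector_eq_iff]
  mono I J hIJ := weightedEntropy_mono hp.1 fun a b => by
    rw [subvector_eq_iff, subvector_eq_iff]
    exact fun h i hi => h i (hIJ hi)
  submodular I J := by
    have h := weightedEntropy_submodular hp (X := fun ω (i : I) => ξ i ω)
      (Y := fun ω (i : J) => ξ i ω) (Z := fun ω (i : ↥(I ∩ J)) => ξ i ω)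
      (fun a b => by
        rw [subvector_eq_iff, subvector_eq_iff]
        exact fun h i hi => h i (mem_inter.1 hi).1)
      (fun a b => by
        rw [subvector_eq_iff, subvector_eq_iff]
        exact fun h i hi => h i (mem_inter.1 hi).2)
    rw [weightedEntropy_congr p (Y := fun ω (i : ↥(I ∪ J)) => ξ i ω)
      (fun a b => by
        rw [Prod.mk.injEq, subvector_eq_iff, subvector_eq_iff, subvector_eq_iff]
        constructor
        · rintro ⟨h1, h2⟩ i hi
          exact (mem_union.1 hi).elim (h1 i) (h2 i)
        · exact fun h => ⟨fun i hi => h i (mem_union_left _ hi),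
            fun i hi => h i (mem_union_right _ hi)⟩)] at h
    simp only [entropyVector]
    linarith

lemma isClosed_setOf_isPolymatroid : IsClosed {h : Finset N → ℝ | IsPolymatroid h} := by
  have : {h : Finset N → ℝ | IsPolymatroid h} = {h | h ∅ = 0} ∩
      (⋂ I, ⋂ J, ⋂ (_ : I ⊆ J), {h | h I ≤ h J}) ∩
      ⋂ I, ⋂ J, {h | 0 ≤ h I + h J - h (I ∪ J) - h (I ∩ J)} := by
    ext h
    simp only [Set.mem_ofPred_eq, Set.mem_inter_iff, Set.mem_iInter]
    exact ⟨fun h => ⟨⟨h.1, h.2⟩, h.3⟩, fun h => ⟨h.1.1, h.1.2, h.2⟩⟩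
  rw [this]
  refine ((isClosed_eq (by fun_prop) (by fun_prop)).inter ?_).inter ?_
  · exact isClosed_iInter fun I => isClosed_iInter fun J => isClosed_iInter fun _ =>
      isClosed_le (by fun_prop) (by fun_prop)
  · exact isClosed_iInter fun I => isClosed_iInter fun J =>
      isClosed_le (by fun_prop) (by fun_prop)

variable [Fintype N]

lemma isPolymatroid_of_mem_closure {h : Finset N → ℝ} (hh : h ∈ closure (entropyRegion N)) :
    IsPolymatroid h := by
  refine closure_minimal (fun g hg => ?_) isClosed_setOf_isPolymatroid hh
  obtain ⟨Ω, _, S, _, p, ξ, hp, rfl⟩ := exists_eq_entropyVector hg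
  exact isPolymatroid_entropyVector hp ξ

lemma add_mem_entropyRegion {g h : Finset N → ℝ} (hg : g ∈ entropyRegion N)
    (hh : h ∈ entropyRegion N) : g + h ∈ entropyRegion N := by
  obtain ⟨Ω, _, S, _, p, ξ, hp, rfl⟩ := exists_eq_entropyVector hg
  obtain ⟨Ω', _, S', _, q, η, hq, rfl⟩ := exists_eq_entropyVector hh
  rw [← entropyVector_prodWeight hp hq]
  exact entropyVector_mem (prodWeight_mem hp hq) _

lemma zero_mem_entropyRegion : (0 : Finset N → ℝ) ∈ entropyRegion N := by
  have hp : (fun _ : Unit => (1 : ℝ)) ∈ stdSimplex ℝ Unit := ⟨fun _ => zero_le_one, by simp⟩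
  have : entropyVector (fun _ : Unit => (1 : ℝ)) (fun (_ : N) (_ : Unit) => ()) = 0 :=
    funext fun I => weightedEntropy_of_subsingleton hp fun _ _ => rfl
  rw [← this]
  exact entropyVector_mem hp _

lemma nsmul_mem_entropyRegion {h : Finset N → ℝ} (hh : h ∈ entropyRegion N) (n : ℕ) :
    n • h ∈ entropyRegion N := by
  induction n with
  | zero => simpa using zero_mem_entropyRegion
  | succ n ih => rw [succ_nsmul]; exact add_mem_entropyRegion ih hh

/-- With probability `1 - δ` all components are erased together. Every nonempty subvector sees this
switch, so its entropy is added uniformly. -/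
lemma smul_add_binEntropy_mem_entropyRegion {h : Finset N → ℝ} (hh : h ∈ entropyRegion N) {δ : ℝ}
    (h0 : 0 < δ) (h1 : δ ≤ 1) :
    (δ • h + Real.binEntropy δ • fun I : Finset N => if I = ∅ then 0 else 1) ∈ entropyRegion N := by
  obtain ⟨Ω, _, S, _, p, ξ, hp, rfl⟩ := exists_eq_entropyVector hh
  have hm := optionWeight_mem h0.le h1 hp
  convert entropyVector_mem hm fun i => Option.map (ξ i) using 1
  funext I
  rcases I.eq_empty_or_nonempty with rfl | ⟨i, hi⟩
  · simp [(isPolymatroid_entropyVector hp ξ).empty, (isPolymatroid_entropyVector hm _).empty]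
  · have hne : I ≠ ∅ := ne_empty_of_mem hi
    simp only [Pi.add_apply, Pi.smul_apply, smul_eq_mul, hne, if_false, mul_one]
    refine (weightedEntropy_optionWeight h0 hp (fun a h => ?_) fun a b => ?_).symm
    · have := congrFun h ⟨i, hi⟩
      simp at this
    · rw [subvector_eq_iff ξ, subvector_eq_iff fun i => Option.map (ξ i)]
      simp

-- Activating `n` independent copies with probability `c / n` gives `c • g` up to the entropy of the
-- switch, which tends to 0.
open Topology Filter in
lemma smul_mem_closure_entropyRegion {h : Finset N → ℝ} (hh : h ∈ closure (entropyRegion N))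
    {c : ℝ} (hc : 0 ≤ c) : c • h ∈ closure (entropyRegion N) := by
  rcases hc.eq_or_lt with rfl | hc
  · rw [zero_smul]; exact subset_closure zero_mem_entropyRegion
  suffices H : ∀ g ∈ entropyRegion N, c • g ∈ closure (entropyRegion N) by
    have := map_mem_closure (continuous_const_smul c) hh H
    rwa [closure_closure] at this
  intro g hg
  have hlim : Tendsto (fun n : ℕ => c / n) atTop (𝓝 0) := tendsto_const_div_atTop_nhds_zero_nat c
  have hbin : Tendsto (fun n : ℕ => Real.binEntropy (c / n)) atTop (𝓝 0) := by
    simpa [Function.comp_def] using (Real.binEntropy_continuous.tendsto 0).comp hlim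
  have htend : Tendsto (fun n : ℕ => c • g + Real.binEntropy (c / n) •
      fun I : Finset N => if I = ∅ then (0 : ℝ) else 1) atTop (𝓝 (c • g)) := by
    simpa using tendsto_const_nhds.add
      (hbin.smul_const fun I : Finset N => if I = ∅ then (0 : ℝ) else 1)
  refine mem_closure_of_tendsto htend ?_
  filter_upwards [hlim.eventually (gt_mem_nhds zero_lt_one), eventually_gt_atTop 0] with n hn hn0
  have hn0' : (0 : ℝ) < n := Nat.cast_pos.2 hn0
  have := smul_add_binEntropy_mem_entropyRegion (nsmul_mem_entropyRegion hg n)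
    (div_pos hc hn0') hn.le
  rwa [← Nat.cast_smul_eq_nsmul ℝ, smul_smul, div_mul_cancel₀ c hn0'.ne'] at this

lemma add_mem_closure_entropyRegion {g h : Finset N → ℝ} (hg : g ∈ closure (entropyRegion N))
    (hh : h ∈ closure (entropyRegion N)) : g + h ∈ closure (entropyRegion N) :=
  map_mem_closure₂ continuous_add hg hh fun _ ha _ hb => add_mem_entropyRegion ha hb

variable (N) in
/-- The closure of the entropy region, as a convex cone. -/
def closureCone : PointedCone ℝ (Finset N → ℝ) where
  carrier := closure (entropyRegion N)
  add_mem' := add_mem_closure_entropyRegion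
  zero_mem' := subset_closure zero_mem_entropyRegion
  smul_mem' c _ hx := smul_mem_closure_entropyRegion hx c.2

lemma mem_closureCone {h : Finset N → ℝ} :
    h ∈ closureCone N ↔ h ∈ closure (entropyRegion N) := Iff.rfl

/-- The entropy vector of a fair coin at `i` and constants elsewhere. -/
lemma coin_mem_entropyRegion (i : N) :
    (fun I : Finset N => if i ∈ I then Real.log 2 else 0) ∈ entropyRegion N := by
  have hp : (fun _ : Bool => (1 / 2 : ℝ)) ∈ stdSimplex ℝ Bool := ⟨fun _ => by norm_num, by simp⟩
  convert entropyVector_mem hp fun (j : N) (b : Bool) => decide (j = i) && b using 1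
  funext I
  split_ifs with hi
  · have h : ∀ a b : Bool, (fun j : I => decide ((j : N) = i) && a) =
        (fun j : I => decide ((j : N) = i) && b) ↔ a = b := by
      refine fun a b => ⟨fun h => ?_, fun h => by rw [h]⟩
      simpa using congrFun h ⟨i, hi⟩
    rw [entropyVector, weightedEntropy_congr _ (Y := fun b : Bool => b) h]
    simp [weightedEntropy, classMass]
  · refine (weightedEntropy_of_subsingleton hp fun a b => ?_).symm
    funext j
    have : (j : N) ≠ i := fun h => hi (h ▸ j.2)
    simp [this]

lemma indicator_mem_closureCone (i : N) {c : ℝ} (hc : 0 ≤ c) :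
    (fun I : Finset N => if i ∈ I then c else 0) ∈ closureCone N := by
  have h := smul_mem_closure_entropyRegion (subset_closure (coin_mem_entropyRegion i))
    (c := c / Real.log 2) (div_nonneg hc (Real.log_nonneg one_le_two))
  rw [mem_closureCone]
  convert h using 1
  funext I
  have : Real.log 2 ≠ 0 := (Real.log_pos one_lt_two).ne'
  by_cases hi : i ∈ I <;> simp [hi, this]

end Region

/-! ### Random hashing and nearly independent extraction. -/

section Hash

variable {Ω T : Type*} [Fintype Ω]

/-- In a collision `f a` is forced by `f b`, so colliding functions are counted by their
restrictions away from `a`. -/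
lemma card_collision_mul {S : Type*} [Fintype S] [DecidableEq S] (M : ℕ) {a b : S} (hab : a ≠ b) :
    (#{f : S → Fin M | f a = f b} : ℝ) * M = Fintype.card (S → Fin M) := by
  have h1 : #{f : S → Fin M | f a = f b} = Fintype.card ({j // j ≠ a} → Fin M) := by
    rw [card_filter, ← (Equiv.funSplitAt a (Fin M)).symm.sum_comp, Fintype.sum_prod_type,
      sum_comm]
    simp [Equiv.funSplitAt, Equiv.piSplitAt, hab.symm]
  rw [h1, Fintype.card_congr (Equiv.funSplitAt a (Fin M)), Fintype.card_prod, Fintype.card_fin]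
  push_cast
  ring

/-- Points with equal `X` always collide; the others do so for a fraction `1 / M` of the hash
functions. -/
lemma sum_classMass_hash_le {p : Ω → ℝ} (hp : ∀ ω, 0 ≤ p ω) {S : Type*} [Fintype S]
    [DecidableEq S] (X : Ω → S) (Y : Ω → T) {M : ℕ} (hM : 0 < M) (ω : Ω) :
    ∑ f : S → Fin M, classMass p (fun ω => (f (X ω), Y ω)) ω ≤
      Fintype.card (S → Fin M) * (classMass p (fun ω => (X ω, Y ω)) ω + classMass p Y ω / M) := by
  classical
  have hM' : (0 : ℝ) < M := Nat.cast_pos.2 hM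
  simp only [classMass, Prod.mk.injEq]
  rw [sum_comm, sum_div, ← sum_add_distrib, mul_sum]
  refine sum_le_sum fun a _ => ?_
  by_cases hY : Y a = Y ω
  · by_cases hX : X a = X ω
    · simp only [hX, hY, and_self, if_true, sum_const, card_univ, nsmul_eq_mul]
      exact mul_le_mul_of_nonneg_left
        (le_add_of_nonneg_right (div_nonneg (hp a) hM'.le)) (Nat.cast_nonneg _)
    · simp only [hX, hY, and_true, if_true, if_false, zero_add]
      rw [← sum_filter, sum_const, nsmul_eq_mul, ← card_collision_mul M hX]
      refine le_of_eq ?_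
      field_simp
  · simp [hY]

/-- Averaging over all hash functions of `X` gives one whose conditional entropy given `Y` is
large. -/
lemma exists_hash {p : Ω → ℝ} (hp : ∀ ω, 0 ≤ p ω) {S : Type*} [Fintype S] (X : Ω → S)
    (Y : Ω → T) {M : ℕ} (hM : 0 < M) :
    ∃ f : S → Fin M,
      -∑ ω, p ω * Real.log (classMass p (fun ω => (X ω, Y ω)) ω + classMass p Y ω / M) ≤
        weightedEntropy p fun ω => (f (X ω), Y ω) := by
  classical
  have hM' : (0 : ℝ) < M := Nat.cast_pos.2 hM
  have : Nonempty (Fin M) := ⟨⟨0, hM⟩⟩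
  set K : ℝ := (Fintype.card (S → Fin M) : ℝ) with hK
  set a : Ω → ℝ := fun ω => classMass p (fun ω => (X ω, Y ω)) ω + classMass p Y ω / M with ha
  have key : ∀ ω, ∑ f : S → Fin M, p ω * Real.log (classMass p (fun ω => (f (X ω), Y ω)) ω) ≤
      K * (p ω * Real.log (a ω)) := by
    intro ω
    by_cases h0 : p ω = 0
    · simp [h0]
    have hapos : 0 < a ω := add_pos (classMass_pos hp _ h0) (div_pos (classMass_pos hp Y h0) hM')
    -- Jensen's inequality for `log`, through the tangent line at `a ω`, which bounds the average
    -- class mass.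
    have hlog : ∀ f : S → Fin M, Real.log (classMass p (fun ω => (f (X ω), Y ω)) ω) ≤
        Real.log (a ω) - 1 + classMass p (fun ω => (f (X ω), Y ω)) ω / a ω := by
      intro f
      have hm := classMass_pos hp (fun ω => (f (X ω), Y ω)) h0
      have := Real.log_le_sub_one_of_pos (div_pos hm hapos)
      rw [Real.log_div hm.ne' hapos.ne'] at this
      linarith
    have h1 := sum_le_sum fun f (_ : f ∈ univ) => hlog f
    rw [sum_add_distrib, ← sum_div, sum_const, card_univ, nsmul_eq_mul, ← hK] at h1
    have h2 : (∑ f : S → Fin M, classMass p (fun ω => (f (X ω), Y ω)) ω) / a ω ≤ K :=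
      (div_le_iff₀ hapos).2 (sum_classMass_hash_le hp X Y hM ω)
    rw [← mul_sum, mul_left_comm]
    refine mul_le_mul_of_nonneg_left ?_ (hp ω)
    linarith
  have hsum := sum_le_sum fun ω (_ : ω ∈ univ) => key ω
  rw [sum_comm, ← mul_sum] at hsum
  obtain ⟨f, -, hf⟩ := exists_le_of_sum_le (s := (univ : Finset (S → Fin M)))
    (f := fun f => ∑ ω, p ω * Real.log (classMass p (fun ω => (f (X ω), Y ω)) ω))
    (g := fun _ => ∑ ω, p ω * Real.log (a ω)) univ_nonempty (by
      rwa [sum_const, card_univ, nsmul_eq_mul, ← hK])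
  exact ⟨f, neg_le_neg hf⟩

lemma exists_nat_log_le_and_inv_le {t : ℝ} (ht : 0 ≤ t) :
    ∃ M : ℕ, 0 < M ∧ Real.log M ≤ t ∧ (M : ℝ)⁻¹ ≤ 2 * Real.exp (-t) := by
  have h1 : 1 ≤ ⌊Real.exp t⌋₊ := Nat.one_le_floor_iff _ |>.2 (Real.one_le_exp ht)
  have h1' : (1 : ℝ) ≤ ⌊Real.exp t⌋₊ := by exact_mod_cast h1
  refine ⟨⌊Real.exp t⌋₊, h1, ?_, ?_⟩
  · rw [Real.log_le_iff_le_exp (by linarith)]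
    exact Nat.floor_le (Real.exp_pos t).le
  · rw [Real.exp_neg, inv_le_comm₀ (by linarith) (by positivity), mul_inv, inv_inv]
    linarith [Nat.lt_floor_add_one (Real.exp t)]

/-- A hash of `X` with at most `exp t` values that is nearly uniform and nearly independent of `Y`,
provided the conditional information of `X` given `Y` is concentrated around `t`. -/
lemma exists_hash_of_concentrated {p : Ω → ℝ} (hp : p ∈ stdSimplex ℝ Ω) {S : Type*} [Fintype S]
    (X : Ω → S) (Y : Ω → T) {t : ℝ} (ht : 0 ≤ t) :
    ∃ (M : ℕ) (f : S → Fin M), Real.log M ≤ t ∧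
      t - ∑ ω, p ω * |Real.log (classMass p Y ω) -
        Real.log (classMass p (fun ω => (X ω, Y ω)) ω) - t| - Real.log 3 ≤
      weightedEntropy p (fun ω => (f (X ω), Y ω)) - weightedEntropy p Y := by
  obtain ⟨M, hM, hMt, hMinv⟩ := exists_nat_log_le_and_inv_le ht
  obtain ⟨f, hf⟩ := exists_hash hp.1 X Y hM
  refine ⟨M, f, hMt, ?_⟩
  set W : Ω → S × T := fun ω => (X ω, Y ω)
  set D : Ω → ℝ := fun ω =>
    |Real.log (classMass p Y ω) - Real.log (classMass p W ω) - t| with hD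
  have key : ∀ ω, p ω * Real.log (classMass p W ω + classMass p Y ω / M) ≤
      p ω * Real.log (classMass p Y ω) - t * p ω + p ω * D ω + Real.log 3 * p ω := by
    intro ω
    by_cases h0 : p ω = 0
    · simp [h0]
    have hW := classMass_pos hp.1 W h0
    have hY := classMass_pos hp.1 Y h0
    have h1 : classMass p W ω ≤ classMass p Y ω * Real.exp (D ω - t) := by
      rw [← Real.log_le_log_iff hW (by positivity), Real.log_mul hY.ne' (Real.exp_pos _).ne',
        Real.log_exp]
      have := neg_abs_le (Real.log (classMass p Y ω) - Real.log (classMass p W ω) - t)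
      simp only [hD]
      linarith
    have h2 : classMass p Y ω / M ≤ classMass p Y ω * (2 * Real.exp (D ω - t)) := by
      rw [div_eq_mul_inv]
      refine mul_le_mul_of_nonneg_left (hMinv.trans ?_) hY.le
      have : 0 ≤ D ω := abs_nonneg _
      gcongr
      linarith
    -- The constant 3 is 1 from `h1` plus 2 from `h2`, the 2 being the loss from rounding `exp t` to
    -- an integer.
    have h3 : Real.log (classMass p W ω + classMass p Y ω / M) ≤
        Real.log (classMass p Y ω) + Real.log 3 + (D ω - t) := by
      have hM' : (0 : ℝ) < M := Nat.cast_pos.2 hM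
      rw [← Real.log_exp (D ω - t), ← Real.log_mul hY.ne' (by norm_num),
        ← Real.log_mul (by positivity) (Real.exp_pos _).ne']
      refine Real.log_le_log (by positivity) ?_
      linarith
    have := mul_le_mul_of_nonneg_left h3 (hp.1 ω)
    linarith
  have hsum := sum_le_sum fun ω (_ : ω ∈ univ) => key ω
  simp only [sum_add_distrib, sum_sub_distrib, ← mul_sum, hp.2] at hsum
  have hYdef : weightedEntropy p Y = -∑ ω, p ω * Real.log (classMass p Y ω) := rfl
  linarith

end Hash

/-! ### Tightening at one element. -/

section Tightening

variable {N : Type*} [Fintype N] [DecidableEq N]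

/-- By the chain rule this is the average over `v` of the entropy vectors conditioned on `F = v`. -/
lemma condEntropy_mem_closureCone {Ω T : Type*} [Fintype Ω] [Fintype T] {S : N → Type*}
    {p : Ω → ℝ} (hp : p ∈ stdSimplex ℝ Ω) (ξ : ∀ i, Ω → S i) (F : Ω → T) :
    (fun I : Finset N => weightedEntropy p (fun ω => ((fun i : I => ξ i ω), F ω)) -
      weightedEntropy p F) ∈ closureCone N := by
  classical
  have h : (fun I : Finset N => weightedEntropy p (fun ω => ((fun i : I => ξ i ω), F ω)) -
      weightedEntropy p F) =
      ∑ v, (∑ a, if F a = v then p a else 0) • entropyVector (condWeight p F v) ξ := by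
    funext I
    rw [← weightedEntropy_condWeight hp.1, Finset.sum_apply]
    refine sum_congr rfl fun v _ => ?_
    simp only [Pi.smul_apply, smul_eq_mul, entropyVector]
  rw [h]
  refine sum_mem fun v _ => ?_
  by_cases hv : ∑ a, (if F a = v then p a else 0) = 0
  · rw [hv, zero_smul]; exact zero_mem _
  · refine smul_mem_closure_entropyRegion (subset_closure (entropyVector_mem
      (condWeight_mem hp.1 (by convert hv)) ξ)) (sum_nonneg fun a _ => ?_)
    split_ifs <;> simp [hp.1 a]

/-- The information of the family `ξ` given its members other than `i`. -/
noncomputable def condInfo {Ω : Type*} [Fintype Ω] {S : N → Type*} (p : Ω → ℝ)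
    (ξ : ∀ i, Ω → S i) (i : N) (ω : Ω) : ℝ :=
  Real.log (classMass p (fun ω (j : ↥(univ \ {i})) => ξ j ω) ω) -
    Real.log (classMass p (fun ω (j : ↥(univ : Finset N)) => ξ j ω) ω)

/-- The part of `h` owned by `i` alone. -/
def privatePart (i : N) (h : Finset N → ℝ) : ℝ := h univ - h (univ \ {i})

/-- `h` made tight at `i`. -/
def tightenAt (i : N) (h : Finset N → ℝ) : Finset N → ℝ :=
  fun I => h I - if i ∈ I then privatePart i h else 0

lemma IsPolymatroid.privatePart_nonneg {h : Finset N → ℝ} (hh : IsPolymatroid h) (i : N) :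
    0 ≤ privatePart i h :=
  sub_nonneg.2 (hh.mono _ _ (subset_univ _))

/-- The witness is `I ↦ H(ξ_I | F)` with `F` a hash of `ξ i`; it works because `H(F)` and `H(F |
rest)` are both close to `t`. -/
lemma exists_near_tightenAt {Ω : Type*} [Fintype Ω] {S : N → Type*} [∀ i, Fintype (S i)]
    {p : Ω → ℝ} (hp : p ∈ stdSimplex ℝ Ω) (ξ : ∀ i, Ω → S i) (i : N) :
    ∃ v ∈ closureCone N, ∀ I, |v I - tightenAt i (entropyVector p ξ) I| ≤
      ∑ ω, p ω * |condInfo p ξ i ω - privatePart i (entropyVector p ξ)| + Real.log 3 := by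
  set t := privatePart i (entropyVector p ξ) with ht
  have ht0 : 0 ≤ t := (isPolymatroid_entropyVector hp ξ).privatePart_nonneg i
  set Y : Ω → ∀ j : ↥(univ \ {i}), S j := fun ω j => ξ j ω with hYdef
  obtain ⟨M, f, hM, hf⟩ := exists_hash_of_concentrated hp (ξ i) Y ht0
  have hXY : ∀ ω, classMass p (fun ω => (ξ i ω, Y ω)) ω =
      classMass p (fun ω (j : ↥(univ : Finset N)) => ξ j ω) ω := by
    refine classMass_congr p fun a b => ?_
    rw [Prod.mk.injEq, hYdef, subvector_eq_iff, subvector_eq_iff]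
    constructor
    · rintro ⟨h1, h2⟩ j -
      by_cases hj : j = i
      · exact hj ▸ h1
      · exact h2 j (by simp [hj])
    · exact fun h => ⟨h i (mem_univ i), fun j _ => h j (mem_univ j)⟩
  simp only [hXY] at hf
  set e := ∑ ω, p ω * |condInfo p ξ i ω - t| with he
  change t - e - Real.log 3 ≤ _ at hf
  set F : Ω → Fin M := fun ω => f (ξ i ω) with hF
  have hFle : weightedEntropy p F ≤ t := by
    have := weightedEntropy_le_log_card hp F
    rw [Fintype.card_fin] at this
    exact this.trans hM
  have hFge : t - e - Real.log 3 ≤ weightedEntropy p F := by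
    have h1 := weightedEntropy_submodular hp (X := F) (Y := Y) (Z := fun _ => ())
      (fun _ _ _ => rfl) (fun _ _ _ => rfl)
    rw [weightedEntropy_of_subsingleton hp (X := fun _ : Ω => ()) fun _ _ => rfl] at h1
    linarith
  refine ⟨_, condEntropy_mem_closureCone hp ξ F, fun I => ?_⟩
  rw [abs_le]
  by_cases hi : i ∈ I
  · have h1 : weightedEntropy p (fun ω => ((fun j : I => ξ j ω), F ω)) = entropyVector p ξ I := by
      refine weightedEntropy_congr p fun a b => ?_
      rw [Prod.mk.injEq, subvector_eq_iff]
      exact ⟨fun h => h.1, fun h => ⟨h, by simp only [hF, h i hi]⟩⟩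
    simp only [h1, tightenAt, hi, if_true, ← ht]
    constructor <;> linarith [Real.log_nonneg (x := 3) (by norm_num),
      sum_nonneg fun ω (_ : ω ∈ univ) => mul_nonneg (hp.1 ω) (abs_nonneg (condInfo p ξ i ω - t))]
  · have hV : (entropyVector p ξ I) = weightedEntropy p fun ω (j : I) => ξ j ω := rfl
    have h1 := weightedEntropy_submodular hp (X := fun ω (j : I) => ξ j ω) (Y := F)
      (Z := fun _ => ()) (fun _ _ _ => rfl) (fun _ _ _ => rfl)
    rw [weightedEntropy_of_subsingleton hp (X := fun _ : Ω => ()) fun _ _ => rfl] at h1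
    have hI : ∀ a b, Y a = Y b → (fun j : I => ξ j a) = fun j : I => ξ j b := by
      intro a b
      rw [hYdef, subvector_eq_iff, subvector_eq_iff]
      refine fun h j hj => h j ?_
      have : j ≠ i := fun h => hi (h ▸ hj)
      simp [this]
    -- Since `ξ_I` is a function of `Y`, this says `H(F | ξ_I) ≥ H(F | Y)`: `F` is nearly
    -- independent of `ξ_I` too.
    have h2 := weightedEntropy_submodular hp (X := fun ω => ((fun j : I => ξ j ω), F ω)) (Y := Y)
      (Z := fun ω (j : I) => ξ j ω) (fun a b h => (Prod.mk.inj h).1) hI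
    rw [weightedEntropy_congr p (Y := fun ω => (F ω, Y ω)) fun a b => by
      simp only [Prod.mk.injEq]
      exact ⟨fun h => ⟨h.1.2, h.2⟩, fun h => ⟨⟨hI a b h.2, h.1⟩, h.2⟩⟩] at h2
    simp only [tightenAt, hi, if_false, sub_zero, hV]
    constructor <;> linarith [Real.log_nonneg (x := 3) (by norm_num),
      sum_nonneg fun ω (_ : ω ∈ univ) => mul_nonneg (hp.1 ω) (abs_nonneg (condInfo p ξ i ω - t))]

lemma sum_mul_condInfo {Ω : Type*} [Fintype Ω] {S : N → Type*} (p : Ω → ℝ) (ξ : ∀ i, Ω → S i)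
    (i : N) : ∑ ω, p ω * condInfo p ξ i ω = privatePart i (entropyVector p ξ) := by
  simp only [condInfo, privatePart, entropyVector, weightedEntropy, mul_sub, sum_sub_distrib]
  ring

/-- The variance of the conditional information. -/
noncomputable def condInfoVar {Ω : Type*} [Fintype Ω] {S : N → Type*} (p : Ω → ℝ)
    (ξ : ∀ i, Ω → S i) (i : N) : ℝ :=
  ∑ ω, p ω * (condInfo p ξ i ω - privatePart i (entropyVector p ξ)) ^ 2

lemma condInfo_prodWeight {Ω Ω' : Type*} [Fintype Ω] [Fintype Ω'] {S S' : N → Type*}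
    {p : Ω → ℝ} {q : Ω' → ℝ} (hp : ∀ ω, 0 ≤ p ω) (hq : ∀ ω, 0 ≤ q ω)
    (ξ : ∀ i, Ω → S i) (η : ∀ i, Ω' → S' i) (i : N) (z : Ω × Ω') (hz : prodWeight p q z ≠ 0) :
    condInfo (prodWeight p q) (fun i z => (ξ i z.1, η i z.2)) i z =
      condInfo p ξ i z.1 + condInfo q η i z.2 := by
  have h := fun I : Finset N => log_classMass_prodWeight hp hq
    (X := fun ω (j : I) => ξ j ω) (Y := fun ω (j : I) => η j ω)
    (Z := fun z (j : I) => (ξ j z.1, η j z.2)) (fun a b => by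
      simp only [funext_iff, Prod.mk.injEq]
      exact forall_and) z hz
  simp only [condInfo]
  rw [h (univ \ {i}), h univ]
  ring

/-- Conditional information is additive off null points, and the cross term vanishes because `u` is
centred. -/
lemma condInfoVar_prodWeight {Ω Ω' : Type*} [Fintype Ω] [Fintype Ω'] {S S' : N → Type*}
    {p : Ω → ℝ} {q : Ω' → ℝ} (hp : p ∈ stdSimplex ℝ Ω) (hq : q ∈ stdSimplex ℝ Ω')
    (ξ : ∀ i, Ω → S i) (η : ∀ i, Ω' → S' i) (i : N) :
    condInfoVar (prodWeight p q) (fun i z => (ξ i z.1, η i z.2)) i =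
      condInfoVar p ξ i + condInfoVar q η i := by
  set s := privatePart i (entropyVector p ξ) with hs
  set t := privatePart i (entropyVector q η) with ht
  have hst : privatePart i (entropyVector (prodWeight p q) fun i z => (ξ i z.1, η i z.2)) =
      s + t := by
    rw [entropyVector_prodWeight hp hq]
    simp only [privatePart, Pi.add_apply, hs, ht]
    ring
  set u : Ω → ℝ := fun a => condInfo p ξ i a - s with hu
  set v : Ω' → ℝ := fun b => condInfo q η i b - t with hv
  have hu0 : ∑ a, p a * u a = 0 := by
    simp only [hu, mul_sub, sum_sub_distrib, ← sum_mul, sum_mul_condInfo, hp.2, ← hs]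
    ring
  have hterm : ∀ z : Ω × Ω', prodWeight p q z *
      (condInfo (prodWeight p q) (fun i z => (ξ i z.1, η i z.2)) i z - (s + t)) ^ 2 =
      prodWeight p q z * (u z.1 ^ 2 + v z.2 ^ 2) + 2 * ((p z.1 * u z.1) * (q z.2 * v z.2)) := by
    intro z
    by_cases hz : prodWeight p q z = 0
    · have : (p z.1 * u z.1) * (q z.2 * v z.2) = prodWeight p q z * (u z.1 * v z.2) := by
        simp only [prodWeight]; ring
      simp [this, hz]
    · rw [condInfo_prodWeight hp.1 hq.1 ξ η i z hz]
      simp only [prodWeight, hu, hv]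
      ring
  rw [condInfoVar, hst]
  simp only [hterm, sum_add_distrib, ← mul_sum]
  rw [sum_prodWeight_mul_add hp hq (fun a => u a ^ 2) fun b => v b ^ 2,
    Fintype.sum_prod_type]
  dsimp only
  rw [← sum_mul_sum, hu0]
  simp [condInfoVar, hu, hv, hs, ht]

universe u v w in
lemma exists_iid_copies {N : Type w} [Fintype N] [DecidableEq N] {Ω : Type u} [Fintype Ω]
    {S : N → Type v} [∀ i, Fintype (S i)] {p : Ω → ℝ}
    (hp : p ∈ stdSimplex ℝ Ω) (ξ : ∀ i, Ω → S i) (i : N) (n : ℕ) :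
    ∃ (Ω' : Type u) (_ : Fintype Ω') (S' : N → Type v) (_ : ∀ i, Fintype (S' i)) (q : Ω' → ℝ)
      (η : ∀ i, Ω' → S' i), q ∈ stdSimplex ℝ Ω' ∧
      entropyVector q η = ((n + 1 : ℕ) : ℝ) • entropyVector p ξ ∧
      condInfoVar q η i = ((n + 1 : ℕ) : ℝ) * condInfoVar p ξ i := by
  induction n with
  | zero => exact ⟨Ω, inferInstance, S, inferInstance, p, ξ, hp, by simp, by simp⟩
  | succ n ih =>
    obtain ⟨Ω', _, S', _, q, η, hq, h1, h2⟩ := ih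
    refine ⟨Ω' × Ω, inferInstance, fun i => S' i × S i, inferInstance, prodWeight q p,
      fun i z => (η i z.1, ξ i z.2), prodWeight_mem hq hp, ?_, ?_⟩
    · rw [entropyVector_prodWeight hq hp, h1, Nat.cast_succ (n + 1), add_smul, one_smul]
    · rw [condInfoVar_prodWeight hq hp, h2, Nat.cast_succ (n + 1)]
      ring

lemma tightenAt_smul (i : N) (c : ℝ) (h : Finset N → ℝ) :
    tightenAt i (c • h) = c • tightenAt i h := by
  funext I
  by_cases hi : i ∈ I <;> simp [tightenAt, privatePart, hi, mul_sub]

lemma continuous_tightenAt (i : N) : Continuous (tightenAt i) := by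
  refine continuous_pi fun I => ?_
  by_cases hi : i ∈ I
  · simp only [tightenAt, privatePart, hi, if_true]; fun_prop
  · simp only [tightenAt, hi, if_false]; fun_prop

/-- Pointwise `|u| ≤ u² / s + s`; a substitute for Cauchy–Schwarz with a free parameter. -/
lemma sum_mul_abs_le {Ω : Type*} [Fintype Ω] {p : Ω → ℝ} (hp : p ∈ stdSimplex ℝ Ω) (u : Ω → ℝ)
    {s : ℝ} (hs : 0 < s) : ∑ ω, p ω * |u ω| ≤ (∑ ω, p ω * u ω ^ 2) / s + s := by
  have h : ∀ ω, p ω * |u ω| ≤ p ω * u ω ^ 2 / s + p ω * s := by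
    intro ω
    rw [mul_div_assoc, ← mul_add]
    refine mul_le_mul_of_nonneg_left ?_ (hp.1 ω)
    rw [← sq_abs, div_add' _ _ _ hs.ne', le_div_iff₀ hs]
    nlinarith [sq_nonneg (|u ω| - s), sq_nonneg (|u ω|), abs_nonneg (u ω)]
  refine (sum_le_sum fun ω _ => h ω).trans (le_of_eq ?_)
  rw [sum_add_distrib, ← sum_div, ← sum_mul, hp.2, one_mul]

/-- Tightening at a single element preserves the closure of the entropy region. -/
lemma tightenAt_mem_closureCone (i : N) {h : Finset N → ℝ} (hh : h ∈ closureCone N) :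
    tightenAt i h ∈ closureCone N := by
  suffices H : ∀ g ∈ entropyRegion N, tightenAt i g ∈ closure (entropyRegion N) by
    have := map_mem_closure (continuous_tightenAt i) hh H
    rwa [closure_closure] at this
  intro g hg
  obtain ⟨Ω, _, S, _, p, ξ, hp, rfl⟩ := exists_eq_entropyVector hg
  rw [← closure_closure, Metric.mem_closure_iff]
  intro ε hε
  set V := condInfoVar p ξ i
  -- With `m = n + 1` copies and `s = m * (ε / 4)` the variance `m * V` costs only `V / (ε / 4)`.
  -- This `n` absorbs that and `log 3` into a second `m * (ε / 4)`, for a total of at most `m * (ε /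
  -- 2)`.
  obtain ⟨n, hn⟩ := exists_nat_gt ((V / (ε / 4) + Real.log 3) / (ε / 4))
  obtain ⟨Ω', _, S', _, q, η, hq, h1, h2⟩ := exists_iid_copies hp ξ i n
  obtain ⟨v, hv, hvI⟩ := exists_near_tightenAt hq η i
  have hpos : (0 : ℝ) < ((n + 1 : ℕ) : ℝ) := Nat.cast_pos.2 n.succ_pos
  have hlt : (n : ℝ) < ((n + 1 : ℕ) : ℝ) := Nat.cast_lt.2 n.lt_succ_self
  set m : ℝ := ((n + 1 : ℕ) : ℝ)
  refine ⟨m⁻¹ • v, smul_mem_closure_entropyRegion hv (inv_nonneg.2 hpos.le), ?_⟩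
  have hbound : ∑ ω, q ω * |condInfo q η i ω - privatePart i (entropyVector q η)| ≤
      V / (ε / 4) + m * (ε / 4) := by
    refine (sum_mul_abs_le hq _ (mul_pos hpos (by linarith : 0 < ε / 4))).trans (le_of_eq ?_)
    have : ∑ ω, q ω * (condInfo q η i ω - privatePart i (entropyVector q η)) ^ 2 = m * V := h2
    rw [this, mul_div_mul_left _ _ hpos.ne']
  rw [div_lt_iff₀ (by linarith)] at hn
  refine lt_of_le_of_lt ((dist_pi_le_iff (by linarith : 0 ≤ ε / 2)).2 fun I => ?_)
    (half_lt_self hε)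
  have hI := hvI I
  rw [h1, tightenAt_smul] at hI
  rw [dist_comm, Real.dist_eq, Pi.smul_apply, smul_eq_mul]
  have h3 : m⁻¹ * v I - tightenAt i (entropyVector p ξ) I =
      m⁻¹ * (v I - (m • tightenAt i (entropyVector p ξ)) I) := by
    simp only [Pi.smul_apply, smul_eq_mul]
    field_simp
  rw [h3, abs_mul, abs_of_pos (inv_pos.2 hpos), inv_mul_le_iff₀ hpos]
  rw [h1] at hbound
  have : (n : ℝ) * (ε / 4) ≤ m * (ε / 4) := by gcongr
  linarith

end Tightening

/-! ### Decomposition into tight and modular parts. -/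

section DirectSum

variable {N : Type*} [DecidableEq N]

/-- The modular function with the given values on singletons. -/
def modularOf (m : N → ℝ) (I : Finset N) : ℝ := ∑ i ∈ I, m i

lemma modularOf_mem_modularCone {m : N → ℝ} (hm : ∀ i, 0 ≤ m i) :
    modularOf m ∈ modularCone N := by
  have h : ∀ I J : Finset N,
      modularOf m I + modularOf m J - modularOf m (I ∪ J) - modularOf m (I ∩ J) = 0 := by
    intro I J
    have := sum_union_inter (s₁ := I) (s₂ := J) (f := m)
    simp only [modularOf]
    linarith
  refine ⟨⟨sum_empty, fun I J hIJ => ?_, fun I J => (h I J).ge⟩, fun I J _ => h I J⟩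
  exact sum_le_sum_of_subset_of_nonneg hIJ fun i _ _ => hm i

lemma eq_modularOf {h : Finset N → ℝ} (h0 : h ∅ = 0)
    (h1 : ∀ I J : Finset N, Disjoint I J → h I + h J - h (I ∪ J) - h (I ∩ J) = 0) :
    h = modularOf fun i => h {i} := by
  funext I
  induction I using Finset.induction_on with
  | empty => simp [modularOf, h0]
  | insert i I hi ih =>
    have hd : Disjoint {i} I := disjoint_singleton_left.2 hi
    have := h1 {i} I hd
    rw [disjoint_iff_inter_eq_empty.1 hd, h0, ← insert_eq] at this
    rw [modularOf, sum_insert hi, ← modularOf, ← ih]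
    linarith

lemma IsPolymatroid.add {g h : Finset N → ℝ} (hg : IsPolymatroid g) (hh : IsPolymatroid h) :
    IsPolymatroid (g + h) where
  empty := by simp [hg.empty, hh.empty]
  mono I J hIJ := add_le_add (hg.mono I J hIJ) (hh.mono I J hIJ)
  submodular I J := by
    have h1 := hg.submodular I J
    have h2 := hh.submodular I J
    simp only [Pi.add_apply]
    linarith

lemma IsPolymatroid.smul {h : Finset N → ℝ} (hh : IsPolymatroid h) {c : ℝ} (hc : 0 ≤ c) :
    IsPolymatroid (c • h) where
  empty := by simp [hh.empty]
  mono I J hIJ := mul_le_mul_of_nonneg_left (hh.mono I J hIJ) hc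
  submodular I J := by
    have := mul_nonneg hc (hh.submodular I J)
    simp only [Pi.smul_apply, smul_eq_mul]
    linarith

lemma isPolymatroid_zero : IsPolymatroid (0 : Finset N → ℝ) :=
  ⟨rfl, fun _ _ _ => le_rfl, fun _ _ => by simp⟩

variable [Fintype N]

/-- The modular function of the private parts of `h`. -/
def privateModular (h : Finset N → ℝ) : Finset N → ℝ := modularOf fun i => privatePart i h

/-- Tightening at the elements of `J` does not change the private part of any `j ∉ J`, so the steps
can be iterated. -/
lemma sub_modularOf_mem_closureCone {h : Finset N → ℝ} (hh : h ∈ closureCone N) (J : Finset N) :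
    (fun I => h I - ∑ i ∈ I ∩ J, privatePart i h) ∈ closureCone N := by
  induction J using Finset.induction_on with
  | empty => simpa using hh
  | insert j J hj ih =>
    convert tightenAt_mem_closureCone j ih using 1
    funext I
    have hpriv : privatePart j (fun I => h I - ∑ i ∈ I ∩ J, privatePart i h) =
        privatePart j h := by
      have : (univ \ {j}) ∩ J = univ ∩ J := by
        ext i
        simp only [mem_inter, mem_sdiff, mem_univ, mem_singleton, true_and, and_iff_right_iff_imp]
        exact fun hi h => hj (h ▸ hi)
      rw [privatePart, this]
      simp [privatePart]
    rw [tightenAt, hpriv]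
    by_cases hi : j ∈ I
    · rw [inter_insert_of_mem hi, sum_insert fun h => hj (mem_inter.1 h).2, if_pos hi]
      ring
    · rw [inter_insert_of_notMem hi, if_neg hi, sub_zero]

lemma sub_privateModular_mem_closureCone {h : Finset N → ℝ} (hh : h ∈ closureCone N) :
    h - privateModular h ∈ closureCone N := by
  have := sub_modularOf_mem_closureCone hh univ
  simp only [inter_univ] at this
  exact this

lemma sub_privateModular_tight (h : Finset N → ℝ) (i : N) :
    (h - privateModular h) univ = (h - privateModular h) (univ \ {i}) := by
  have := sum_sdiff (f := fun i => privatePart i h) (subset_univ {i})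
  rw [sum_singleton] at this
  simp only [Pi.sub_apply, privateModular, modularOf, ← this]
  simp only [privatePart]
  ring

lemma modularCone_subset_closureCone {h : Finset N → ℝ} (hh : h ∈ modularCone N) :
    h ∈ closureCone N := by
  have h1 : h = ∑ i, fun I : Finset N => if i ∈ I then h {i} else 0 := by
    conv_lhs => rw [eq_modularOf hh.1.empty hh.2]
    funext I
    simp [modularOf, Finset.sum_apply]
  rw [h1]
  refine sum_mem fun i _ => indicator_mem_closureCone i ?_
  rw [← hh.1.empty]
  exact hh.1.mono _ _ (empty_subset _)

variable (N) in
/-- The tight polymatroids, as a convex cone. -/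
def tightPointedCone : PointedCone ℝ (Finset N → ℝ) where
  carrier := tightCone N
  add_mem' := fun hg hh => ⟨hg.1.add hh.1, fun i => by
    simp only [Pi.add_apply, ← hg.2 i, ← hh.2 i]⟩
  zero_mem' := ⟨isPolymatroid_zero, fun _ => rfl⟩
  smul_mem' c _ hh := ⟨hh.1.smul c.2, fun i => congrArg (fun x => (c : ℝ) * x) (hh.2 i)⟩

variable (N) in
/-- The modular polymatroids, as a convex cone. -/
def modularPointedCone : PointedCone ℝ (Finset N → ℝ) where
  carrier := modularCone N
  add_mem' := fun {g h} hg hh => ⟨hg.1.add hh.1, fun I J hIJ => by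
    have h1 := hg.2 I J hIJ
    have h2 := hh.2 I J hIJ
    simp only [Pi.add_apply]
    linarith⟩
  zero_mem' := ⟨isPolymatroid_zero, fun _ _ _ => by simp⟩
  smul_mem' c h hh := ⟨hh.1.smul c.2, fun I J hIJ => by
    have : (c : ℝ) * (h I + h J - h (I ∪ J) - h (I ∩ J)) = 0 := by rw [hh.2 I J hIJ, mul_zero]
    change (c : ℝ) * h I + c * h J - c * h (I ∪ J) - c * h (I ∩ J) = 0
    linarith⟩

/-- The tightness equations and additivity over singletons are linear, so they hold on the spans.
Together they force `h {i} = h univ - h (univ \ {i}) = 0`. -/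
lemma disjoint_span_tightCone_span_modularCone :
    Disjoint (Submodule.span ℝ (tightCone N)) (Submodule.span ℝ (modularCone N)) := by
  rw [Submodule.disjoint_def]
  intro h ht hm
  have htight : ∀ i, h univ = h (univ \ {i}) := by
    refine Submodule.span_induction (p := fun h _ => ∀ i, h univ = h (univ \ {i}))
      (fun g hg => hg.2) (fun _ => rfl) (fun f g _ _ hf hg i => ?_) (fun c g _ hg i => ?_) ht
    · simp only [Pi.add_apply, ← hf i, ← hg i]
    · simp only [Pi.smul_apply, ← hg i]
  have hmod : h = modularOf fun i => h {i} := by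
    refine Submodule.span_induction (p := fun h _ => h = modularOf fun i => h {i})
      (fun g hg => eq_modularOf hg.1.empty hg.2) (funext fun I => by simp [modularOf])
      (fun f g _ _ hf hg => ?_) (fun c g _ hg => ?_) hm
    · conv_lhs => rw [hf, hg]
      funext I
      simp [modularOf, sum_add_distrib]
    · conv_lhs => rw [hg]
      funext I
      simp [modularOf, mul_sum]
  have hzero : ∀ i, h {i} = 0 := by
    intro i
    have h1 := sum_sdiff (f := fun i => h {i}) (subset_univ {i})
    rw [sum_singleton] at h1
    have h2 := congrFun hmod univ
    have h3 := congrFun hmod (univ \ {i})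
    simp only [modularOf] at h2 h3
    linarith [htight i]
  rw [hmod]
  funext I
  simp [modularOf, hzero]

lemma closure_eq_add :
    closure (entropyRegion N) = closure (entropyRegion N) ∩ tightCone N + modularCone N := by
  refine Set.Subset.antisymm (fun h hh => ?_) ?_
  · have hmem := sub_privateModular_mem_closureCone hh
    refine Set.mem_add.2 ⟨h - privateModular h,
      ⟨hmem, isPolymatroid_of_mem_closure hmem, sub_privateModular_tight h⟩, privateModular h,
      modularOf_mem_modularCone
        fun i => (isPolymatroid_of_mem_closure hh).privatePart_nonneg i, sub_add_cancel _ _⟩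
  · rintro _ ⟨g, hg, m, hm, rfl⟩
    exact add_mem_closure_entropyRegion hg.1 (modularCone_subset_closureCone hm)

lemma isDirectSumOfCones_closure_entropyRegion :
    IsDirectSumOfCones (closure (entropyRegion N))
      (closure (entropyRegion N) ∩ tightCone N) (modularCone N) where
  cone_left := ⟨closureCone N ⊓ tightPointedCone N, rfl⟩
  cone_right := ⟨modularPointedCone N, rfl⟩
  eq_add := closure_eq_add
  disjoint := disjoint_span_tightCone_span_modularCone.mono_left
    (Submodule.span_mono Set.inter_subset_right)

end DirectSum

/-! ### Balanced information inequalities. -/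

section Inequalities

variable {N : Type*} [Fintype N] [DecidableEq N]

lemma sum_mul_modularOf (θ : Finset N → ℝ) (m : N → ℝ) :
    ∑ I, θ I * modularOf m I = ∑ i, m i * ∑ I : Finset N with i ∈ I, θ I := by
  simp only [modularOf, mul_sum, sum_filter]
  rw [sum_comm' (t' := univ) (s' := fun i => {I | i ∈ I}) (by simp)]
  refine sum_congr rfl fun i _ => ?_
  rw [sum_filter]
  refine sum_congr rfl fun I _ => ?_
  split_ifs <;> ring

lemma sum_mul_le_zero_of_mem_closure {θ : Finset N → ℝ}
    (hθ : ∀ h ∈ entropyRegion N, ∑ I, θ I * h I ≤ 0) {h : Finset N → ℝ}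
    (hh : h ∈ closure (entropyRegion N)) : ∑ I, θ I * h I ≤ 0 :=
  closure_minimal (s := entropyRegion N) (t := {h : Finset N → ℝ | ∑ I, θ I * h I ≤ 0}) hθ
    (isClosed_le (by fun_prop) continuous_const) hh

/-- A linear inequality extends to the closure, where it can be tested on `h - privateModular h` and
on the indicators of `i ∈ I`. Conversely the two conditions add up, private parts being nonnegative.
-/
lemma balanced_inequality_iff (θ : Finset N → ℝ) :
    (∀ h ∈ entropyRegion N, ∑ I, θ I * h I ≤ 0) ↔
      (∀ h ∈ entropyRegion N, ∑ I, θ I * h I -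
        ∑ i, privatePart i h * ∑ I : Finset N with i ∈ I, θ I ≤ 0) ∧
      ∀ i : N, ∑ I : Finset N with i ∈ I, θ I ≤ 0 := by
  constructor
  · refine fun hθ => ⟨fun h hh => ?_, fun i => ?_⟩
    · have := sum_mul_le_zero_of_mem_closure hθ
        (sub_privateModular_mem_closureCone (subset_closure hh))
      simpa only [Pi.sub_apply, mul_sub, sum_sub_distrib, privateModular,
        sum_mul_modularOf] using this
    · have := sum_mul_le_zero_of_mem_closure hθ (indicator_mem_closureCone i zero_le_one)
      simpa [sum_filter] using this
  · rintro ⟨h1, h2⟩ h hh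
    have hpoly := isPolymatroid_of_mem_closure (subset_closure hh)
    have := sum_nonpos fun i (_ : i ∈ univ) =>
      mul_nonpos_of_nonneg_of_nonpos (hpoly.privatePart_nonneg i) (h2 i)
    linarith [h1 h hh]

end Inequalities

end EntropyRegion

theorem corollaryC {N : Type*} [Fintype N] [DecidableEq N] :
    EntropyRegion.IsDirectSumOfCones
      (closure (EntropyRegion.entropyRegion N))
      (closure (EntropyRegion.entropyRegion N) ∩ EntropyRegion.tightCone N)
      (EntropyRegion.modularCone N) ∧
    ∀ θ : Finset N → ℝ,
      (∀ h ∈ EntropyRegion.entropyRegion N, ∑ I : Finset N, θ I * h I ≤ 0) ↔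
        (∀ h ∈ EntropyRegion.entropyRegion N,
          (∑ I : Finset N, θ I * h I) -
            ∑ i : N, (h Finset.univ - h (Finset.univ \ {i})) *
              ∑ I : Finset N with i ∈ I, θ I ≤ 0) ∧
        ∀ i : N, ∑ I : Finset N with i ∈ I, θ I ≤ 0 :=
  ⟨EntropyRegion.isDirectSumOfCones_closure_entropyRegion,
    fun θ => EntropyRegion.balanced_inequality_iff θ⟩
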